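/- **Setting.** Let $A\in\mathbb R^{n\times p}$ ($p\ge 1$), $\mathcal X\subseteq\mathbb R^p$, $\mathcal Y\subseteq\mathbb R^n$ measurable, $x_{\rm true}\in\mathcal X$, $G:A\mathcal X\to\mathbb R^n$ a differentiable injective link and $y^*=G(Ax_{\rm true})$. For $\tau>0$ the likelihood is $p_\tau(y\mid x)=C_{y,\tau}\exp\{-\tilde f_y(Ax)/\tau\}$, $y\in\mathcal Y$, a probability density with respect to Lebesgue or counting measure for every $x\in\mathcal X$, and for every $\mu_0\in A\mathcal X$ the function $\tilde f_{G(\mu_0)}$ has its unique minimum over $A\mathcal X$ at $\mu_0$. The observation $Y=Y_\tau$ has density $p_\tau(\cdot\mid x_{\rm true})$ and $Y_\tau\to y^*$ in probability as $\tau\to0$. The prior density is proportional to $e^{-g(x)/\gamma^2}$ on $\mathcal X$, possibly improper, with $\gamma=\gamma(\tau)$; put $\nu=\tau/\gamma^2>0$ and $h_y(x)=\tilde f_y(Ax)+\nu g(x)$. The posterior $\mu_{\rm post}$ has density proportional to $e^{-h_Y(x)/\tau}$ on $\mathcal X$. Norms of vectors are Euclidean, norms of matrices are spectral. $B(x,r)$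 is the closed ball. $\rho_{\rm K}(\xi_1,\xi_2)=\inf\{\varepsilon>0:\mathbb P(d(\xi_1,\xi_2)>\varepsilon)<\varepsilon\}$ is the Ky Fan distance, for random vectors with the Euclidean distance $d$ and for random measures with the Prokhorov distance. Write $\rho=\rho_{\rm K}(Y,y^*)$ and $\mathcal Y_{\rm loc}=\{y\in\mathcal Y:\|y-y^*\|\le\rho\}$. **Assumptions.** All conditions below involving $\tau$ are for all sufficiently small $\tau>0$, or in the limit $\tau\to0$. 1. $\int_{\mathcal X}e^{-h_y(x)/\tau}dx<\infty$ for all $y\in\mathcal Y$, and $x^\star$ is the unique minimiser of $g$ over $\{x\in\mathcal X:Ax=Ax_{\rm true}\}$. It is an interior point of $\mathcal X$. 2. Let $\delta=\delta(\tau)>0$. There are positive definite matrices $C_f\in\mathbb R^{n\times n}$, $C_g\in\mathbb R^{p\times p}$, which may depend on $\tau$ but are bounded as $\tau\to 0$, such that for $x\in B(x^\star,\delta)$ and $y\in\mathcal Y_{\rm loc}$ $$|v^T(\nabla^2\tilde f_y(Ax)-\nabla^2\tilde f_y(Ax^\star))v|\le\delta\|A\|\,v^TC_fv\ (v\in\mathbb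 R^n),\qquad |v^T(\nabla^2g(x)-\nabla^2g(x^\star))v|\le\delta\,v^TC_gv\ (v\in\mathbb R^p).$$ Moreover $g$ is $C^2$ at the points of $B(x^\star,\delta)$, and $\tilde f_y$ is $C^2$ at the points of $A\,B(x^\star,\delta)$ for $y\in\mathcal Y_{\rm loc}\cup\{y^*\}$. 3. There are fixed positive definite $M_{f1},M_{f2}\in\mathbb R^{n\times n}$ such that for $y\in\mathcal Y_{\rm loc}$, all $W\in\mathbb R^{p\times n}$ and all $v\in\mathbb R^n$ $$\|W(\nabla\tilde f_y(Ax^\star)-\nabla\tilde f_{y^*}(Ax^\star))\|\le\|WM_{f1}(y-y^*)\|,$$ $$|v^T(\nabla^2\tilde f_y(Ax^\star)-\nabla^2\tilde f_{y^*}(Ax^\star))v|\le v^TM_{f2}^{1/2}\,{\rm diag}(|y_j-y^*_j|)\,M_{f2}^{1/2}v.$$ 4. $\delta\to0$, $\delta/\sqrt\tau\to\infty$, $(\rho+\nu)/\delta\to0$, $\delta(\rho+\nu)^2/\tau\to0$ and, if $A^TA$ is not of full rank, $\delta/\gamma\to\infty$. Moreover $$\sup_{y\in\mathcal Y_{\rm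 loc}}\frac{\int_{\mathcal X\setminus B(x^\star,\delta)}e^{-[h_y(x)-h_y(x^\star)]/\tau}dx}{\int_{\mathcal X\cap B(x^\star,\delta)}e^{-[h_y(x)-h_y(x^\star)]/\tau}dx}\to0 .$$ 5. $V=\nabla^2\tilde f_{y^*}(Ax^\star)$ and $H_\nu=A^TVA+\nu\nabla^2g(x^\star)$ are positive definite. Put $D=\|A\|A^TC_fA+\nu C_g$, $\tilde\lambda=\delta\|H_\nu^{-1}D\|+\rho\,\|H_\nu^{-1}A^TM_{f2}A\|$, $\bar c_1=\|H_\nu^{-1}A^TM_{f1}\|/(1-\tilde\lambda)$ and $\bar c_2=\|H_\nu^{-1}\nabla g(x^\star)\|/(1-\tilde\lambda)$. **Conclusion.** As $\tau\to0$, the posterior converges to $\delta_{x^\star}$, i.e. $\rho_{\rm K}(\mu_{\rm post},\delta_{x^\star})\to0$, and all of the following conditions, which are therefore necessary for this convergence under the assumptions above, hold: $$\rho_{\rm K}(Y,y^*)\to0,\qquad \nu\to0,\qquad \tau\,{\rm tr}(H_\nu^{-1})\to0,\qquad \delta\to0,\qquad \frac{\lambda_{\min}(H_\nu)\,\delta^2}{\tau}\to\infty,$$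 $$\tilde\lambda<1\ \text{ and }\ \delta>\tfrac12\big(\bar c_1\,\rho_{\rm K}(Y,y^*)+\bar c_2\,\nu\big)\ \text{ for all sufficiently small }\tau,\qquad \frac{\delta\,\rho_{\rm K}(Y,y^*)}{\sqrt\tau}\to0 .$$ -/

import Mathlib

open MeasureTheory Filter Set Topology

noncomputable section

namespace BayesGLIP

open scoped Matrix Matrix.Norms.L2Operator MatrixOrder Gradient

/-- The Euclidean space `ℝᵏ` with the `ℓ²` norm. -/
abbrev E (k : ℕ) : Type := EuclideanSpace ℝ (Fin k)

/-- The matrix-vector product, between Euclidean spaces. -/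
abbrev mul {k l : ℕ} (M : Matrix (Fin k) (Fin l) ℝ) (v : E l) : E k := Matrix.toEuclideanLin M v

/-- The quadratic form `vᵀ M v`. -/
def quad {k : ℕ} (M : Matrix (Fin k) (Fin k) ℝ) (v : E k) : ℝ := inner ℝ v (mul M v)

/-- The Hessian matrix `(∂²F / ∂xᵢ ∂xⱼ)` of `F` at `x`. -/
def hess {k : ℕ} (F : E k → ℝ) (x : E k) : Matrix (Fin k) (Fin k) ℝ :=
  Matrix.of fun i j =>
    fderiv ℝ (fderiv ℝ F) x (EuclideanSpace.single i 1) (EuclideanSpace.single j 1)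

/-- The smallest eigenvalue of a real symmetric matrix. -/
def lambdaMin {k : ℕ} (M : Matrix (Fin k) (Fin k) ℝ) : ℝ := sInf (spectrum ℝ M)

/-- The Ky Fan distance `inf {ε > 0 : P(d(ξ₁, ξ₂) > ε) < ε}` between two random elements `ξ₁`, `ξ₂`
of a space with distance function `d`. -/
def kyFan {Ω W : Type*} [MeasurableSpace Ω] (P : Measure Ω) (d : W → W → ℝ) (ξ₁ ξ₂ : Ω → W) : ℝ :=
  sInf {ε : ℝ | 0 < ε ∧ P {ω | ε < d (ξ₁ ω) (ξ₂ ω)} < ENNReal.ofReal ε}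

/-- The data of a Bayesian generalised linear inverse problem with `p` unknowns and `n`
observations. -/
structure Problem (n p : ℕ) where
  /-- the forward matrix -/
  A : Matrix (Fin n) (Fin p) ℝ
  /-- the parameter set -/
  X : Set (E p)
  /-- the observation set -/
  Yset : Set (E n)
  /-- the link function, of which only the values on `A X` matter -/
  G : E n → E n
  /-- `f y η`: the negative log-likelihood as a function of `η = A x`, up to the factor `1 / τ` -/
  f : E n → E n → ℝ
  /-- the normalising factor `C τ y` of the likelihood -/
  C : ℝ → E n → ℝ
  /-- the reference measure of the likelihood -/
  ref : Measure (E n)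
  /-- the negative log-prior density, up to the factor `1 / γ²` and an additive constant -/
  g : E p → ℝ
  /-- the true value of the parameter -/
  xTrue : E p
  /-- the candidate point of concentration -/
  xStar : E p

namespace Problem

variable {n p : ℕ} (M : Problem n p)

/-- The image `A X` of the parameter set. -/
def AX : Set (E n) := mul M.A '' M.X

/-- The exact data `G (A xTrue)`. -/
def yExact : E n := M.G (mul M.A M.xTrue)

/-- The distribution of the observations for noise level `τ` and parameter `x`: its density with
respect to the reference measure on the observation set is `C_{y,τ} exp (-f_y(A x) / τ)`. -/
def likelihood (τ : ℝ) (x : E p) : Measure (E n) :=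
  (M.ref.restrict M.Yset).withDensity
    fun y => ENNReal.ofReal (M.C τ y * Real.exp (-(M.f y (mul M.A x)) / τ))

/-- `h_y(x) = f_y(A x) + ν g(x)`. -/
def h (ν : ℝ) (y : E n) (x : E p) : ℝ := M.f y (mul M.A x) + ν * M.g x

/-- The posterior density, up to normalisation, as a measure concentrated on `X`. -/
def unnormPosterior (ν τ : ℝ) (y : E n) : Measure (E p) :=
  (volume.restrict M.X).withDensity fun x => ENNReal.ofReal (Real.exp (-(M.h ν y x) / τ))

/-- The posterior distribution given the observation `y`: its density on `X` is proportional to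
`exp (-h_y(x) / τ)`. -/
def posterior (ν τ : ℝ) (y : E n) : Measure (E p) :=
  (M.unnormPosterior ν τ y univ)⁻¹ • M.unnormPosterior ν τ y

/-- `V_y(x)`, the Hessian of `f_y` at `A x`. -/
def V (y : E n) (x : E p) : Matrix (Fin n) (Fin n) ℝ := hess (M.f y) (mul M.A x)

/-- `H_ν = Aᵀ V_{yExact}(xStar) A + ν ∇²g(xStar)`. -/
def H (ν : ℝ) : Matrix (Fin p) (Fin p) ℝ :=
  M.Aᵀ * M.V M.yExact M.xStar * M.A + ν • hess M.g M.xStar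

/-- The observations at distance at most `ρ` from the exact data. -/
def Yloc (ρ : ℝ) : Set (E n) := {y ∈ M.Yset | dist y M.yExact ≤ ρ}

/-- `Δ₀`: the ratio of the posterior masses outside and inside the ball of radius `δ` around
`xStar`. -/
def Δ₀ (ν τ δ : ℝ) (y : E n) : ℝ :=
  (∫ x in M.X \ Metric.closedBall M.xStar δ, Real.exp (-(M.h ν y x - M.h ν y M.xStar) / τ)) /
    ∫ x in M.X ∩ Metric.closedBall M.xStar δ, Real.exp (-(M.h ν y x - M.h ν y M.xStar) / τ)

/-- `D = Aᵀ C_f A ‖A‖ + ν C_g`. -/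
def D (ν : ℝ) (Cf : Matrix (Fin n) (Fin n) ℝ) (Cg : Matrix (Fin p) (Fin p) ℝ) :
    Matrix (Fin p) (Fin p) ℝ :=
  ‖M.A‖ • (M.Aᵀ * Cf * M.A) + ν • Cg

/-- `λ̃ = δ ‖H_ν⁻¹ D‖ + ρ ‖H_ν⁻¹ Aᵀ M_{f2} A‖`. -/
def lambdaTilde (ν δ ρ : ℝ) (Cf Mf2 : Matrix (Fin n) (Fin n) ℝ)
    (Cg : Matrix (Fin p) (Fin p) ℝ) : ℝ :=
  δ * ‖(M.H ν)⁻¹ * M.D ν Cf Cg‖ + ρ * ‖(M.H ν)⁻¹ * M.Aᵀ * Mf2 * M.A‖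

/-- `c₁ = ‖H_ν⁻¹ Aᵀ M_{f1}‖`. -/
def c₁ (ν : ℝ) (Mf1 : Matrix (Fin n) (Fin n) ℝ) : ℝ := ‖(M.H ν)⁻¹ * M.Aᵀ * Mf1‖

/-- `c₂ = ‖H_ν⁻¹ ∇g(xStar)‖`. -/
def c₂ (ν : ℝ) : ℝ := ‖mul (M.H ν)⁻¹ (∇ M.g M.xStar)‖

/-- The likelihood is a family of probability densities with respect to Lebesgue or counting
measure on the observation set, the link is differentiable and invertible, and the likelihood is
identifiable: for exact data `G μ₀`, the function `f_{G μ₀}` has its unique minimum over `A X`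
at `μ₀`. -/
structure IsModel : Prop where
  measurableSet_X : MeasurableSet M.X
  measurableSet_Yset : MeasurableSet M.Yset
  xTrue_mem : M.xTrue ∈ M.X
  link_injOn : InjOn M.G M.AX
  link_differentiableOn : DifferentiableOn ℝ M.G M.AX
  ref_eq : M.ref = volume ∨ M.ref = Measure.count
  C_nonneg : ∀ τ > 0, ∀ y ∈ M.Yset, 0 ≤ M.C τ y
  density_aemeasurable : ∀ τ > 0, ∀ x ∈ M.X,
    AEMeasurable (fun y => M.C τ y * Real.exp (-(M.f y (mul M.A x)) / τ)) (M.ref.restrict M.Yset)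
  likelihood_isProbability : ∀ τ > 0, ∀ x ∈ M.X, IsProbabilityMeasure (M.likelihood τ x)
  identifiable : ∀ μ₀ ∈ M.AX, ∀ η ∈ M.AX, η ≠ μ₀ → M.f (M.G μ₀) μ₀ < M.f (M.G μ₀) η

/-- For every noise level `τ > 0` the observation `Y τ` has the distribution given by the
likelihood at `xTrue`, and `Y τ` converges in probability to the exact data as `τ → 0`. -/
structure IsData {Ω : Type*} [MeasurableSpace Ω] (P : ℝ → Measure Ω) (Y : ℝ → Ω → E n) :
    Prop where
  measurable : ∀ τ > 0, Measurable (Y τ)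
  law : ∀ τ > 0, (P τ).map (Y τ) = M.likelihood τ M.xTrue
  tendsto : ∀ ε > 0, Tendsto (fun τ => P τ {ω | ε ≤ dist (Y τ ω) M.yExact}) (𝓝[>] 0) (𝓝 0)

/-- The posterior is proper, and `xStar` is the unique minimiser of `g` over the solutions in `X` of
the exact problem. -/
structure PriorAssumptions (ν : ℝ → ℝ) : Prop where
  proper : ∃ τ₀ > 0, ∀ τ ∈ Ioc 0 τ₀, ∀ y ∈ M.Yset,
    IntegrableOn (fun x => Real.exp (-(M.h (ν τ) y x) / τ)) M.X
  xStar_mem : M.xStar ∈ M.X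
  xStar_solution : mul M.A M.xStar = mul M.A M.xTrue
  xStar_unique : ∀ x ∈ M.X, mul M.A x = mul M.A M.xTrue → x ≠ M.xStar → M.g M.xStar < M.g x

/-- Smoothness in `x`, near `xStar` and uniformly over the data near the exact data. The matrices
`C_f`, `C_g` may depend on `δ` (hence on `τ`) but remain bounded. -/
structure SmoothX (ρ δ : ℝ → ℝ) (Cf : ℝ → Matrix (Fin n) (Fin n) ℝ)
    (Cg : ℝ → Matrix (Fin p) (Fin p) ℝ) : Prop where
  posDef_Cf : ∀ τ > 0, (Cf τ).PosDef
  posDef_Cg : ∀ τ > 0, (Cg τ).PosDef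
  bounded : ∃ K : ℝ, ∀ᶠ τ in 𝓝[>] 0, ‖Cf τ‖ ≤ K ∧ ‖Cg τ‖ ≤ K
  contDiffAt_f : ∀ᶠ τ in 𝓝[>] 0, ∀ y ∈ insert M.yExact (M.Yloc (ρ τ)),
    ∀ x ∈ Metric.closedBall M.xStar (δ τ), ContDiffAt ℝ 2 (M.f y) (mul M.A x)
  contDiffAt_g : ∀ᶠ τ in 𝓝[>] 0,
    ∀ x ∈ Metric.closedBall M.xStar (δ τ), ContDiffAt ℝ 2 M.g x
  bound_f : ∀ᶠ τ in 𝓝[>] 0, ∀ y ∈ M.Yloc (ρ τ), ∀ x ∈ Metric.closedBall M.xStar (δ τ),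
    ∀ v : E n, |quad (M.V y x - M.V y M.xStar) v| ≤ δ τ * ‖M.A‖ * quad (Cf τ) v
  bound_g : ∀ᶠ τ in 𝓝[>] 0, ∀ x ∈ Metric.closedBall M.xStar (δ τ),
    ∀ v : E p, |quad (hess M.g x - hess M.g M.xStar) v| ≤ δ τ * quad (Cg τ) v

/-- Continuity in `y` of the first two derivatives of the log-likelihood at `A xStar`. -/
structure ConvergenceY (ρ : ℝ → ℝ) (Mf1 Mf2 : Matrix (Fin n) (Fin n) ℝ) : Prop where
  posDef_Mf1 : Mf1.PosDef
  posDef_Mf2 : Mf2.PosDef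
  bound_gradient : ∀ᶠ τ in 𝓝[>] 0, ∀ y ∈ M.Yloc (ρ τ), ∀ W : Matrix (Fin p) (Fin n) ℝ,
    ‖mul W (∇ (M.f y) (mul M.A M.xStar) - ∇ (M.f M.yExact) (mul M.A M.xStar))‖ ≤
      ‖mul (W * Mf1) (y - M.yExact)‖
  bound_hess : ∀ᶠ τ in 𝓝[>] 0, ∀ y ∈ M.Yloc (ρ τ), ∀ v : E n,
    |quad (M.V y M.xStar - M.V M.yExact M.xStar) v| ≤
      quad (CFC.sqrt Mf2 * Matrix.diagonal (fun j => |y j - M.yExact j|) * CFC.sqrt Mf2) v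

/-- The conditions on the radius `δ = δ(τ)`, where `γ = √(τ / ν)`. -/
structure DeltaAssumptions (ρ ν δ : ℝ → ℝ) : Prop where
  pos : ∀ τ > 0, 0 < δ τ
  tendsto_zero : Tendsto δ (𝓝[>] 0) (𝓝 0)
  div_sqrt : Tendsto (fun τ => δ τ / √τ) (𝓝[>] 0) atTop
  dominates : Tendsto (fun τ => (ρ τ + ν τ) / δ τ) (𝓝[>] 0) (𝓝 0)
  mul_sq : Tendsto (fun τ => δ τ * (ρ τ + ν τ) ^ 2 / τ) (𝓝[>] 0) (𝓝 0)
  div_gamma : (M.Aᵀ * M.A).rank ≠ p → Tendsto (fun τ => δ τ / √(τ / ν τ)) (𝓝[>] 0) atTop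
  tail : ∀ ε > 0, ∀ᶠ τ in 𝓝[>] 0, ∀ y ∈ M.Yloc (ρ τ), M.Δ₀ (ν τ) τ (δ τ) y ≤ ε

end Problem

end BayesGLIP

end

/-! Two independent arguments carry the theorem.

Concentration: with probability at least `1 - ρ` the observation lies in `Yloc`. There the tail
assumption bounds the posterior mass outside the ball of radius `δ` around `xStar` by any fixed `ε`,
eventually as `τ → 0`. A measure with little mass outside a small ball is Prokhorov-close to the
point mass at its centre, and `δ, ρ → 0` gives Ky Fan convergence (`tendsto_kyFan_posterior`).

Conditions on `H_ν = B + ν Q`, with `B = Aᵀ V A` and `Q = ∇²g(xStar)`: if `A` has a kernel, only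
`‖H_ν⁻¹‖ = O(1/ν)` is available, yet `H_ν⁻¹ B` stays bounded as `ν → 0` (`regularized_bounds`). Both
`Aᵀ` and `∇g(xStar)` factor through `B`: its range is the orthogonal complement of `ker A`, and
`∇g(xStar)` lies in it because `xStar` is an interior minimiser of `g` along `ker A`. Hence `H_ν⁻¹
Aᵀ` and `H_ν⁻¹ ∇g(xStar)` are bounded (`exists_uniform_bounds`), so `λ̃ = O(δ + ρ)`, and `c₁`, `c₂`
are `O(1)`. The trace and eigenvalue conditions need only a coercivity rate `m` of `H_ν` with `m δ²
/ τ → ∞` (`exists_coercivity_rate`). -/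

namespace BayesGLIP

open scoped Matrix Matrix.Norms.L2Operator MatrixOrder Gradient

/-! ### Quadratic forms, inverses and regularised normal matrices -/

section LinearAlgebra

variable {k l m : ℕ}

lemma mul_mul (M : Matrix (Fin k) (Fin l) ℝ) (N : Matrix (Fin l) (Fin m) ℝ) (v : E m) :
    mul (M * N) v = mul M (mul N v) := by
  simp [mul, Matrix.toLpLin_apply]

lemma norm_mul_le (M : Matrix (Fin k) (Fin l) ℝ) (v : E l) : ‖mul M v‖ ≤ ‖M‖ * ‖v‖ :=
  Matrix.l2_opNorm_mulVec M v

lemma norm_le_of_forall_norm_mul_le {M : Matrix (Fin k) (Fin l) ℝ} {K : ℝ} (hK : 0 ≤ K)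
    (h : ∀ v : E l, ‖mul M v‖ ≤ K * ‖v‖) : ‖M‖ ≤ K := by
  rw [Matrix.l2_opNorm_def]
  exact ContinuousLinearMap.opNorm_le_bound _ hK h

lemma inner_mul_transpose (M : Matrix (Fin k) (Fin l) ℝ) (u : E l) (v : E k) :
    inner ℝ u (mul Mᵀ v) = inner ℝ (mul M u) v := by
  have h := Matrix.toEuclideanLin_conjTranspose_eq_adjoint M
  rw [Matrix.conjTranspose_eq_transpose_of_trivial] at h
  rw [mul, h, LinearMap.adjoint_inner_right]

lemma quad_add (M N : Matrix (Fin k) (Fin k) ℝ) (v : E k) :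
    quad (M + N) v = quad M v + quad N v := by
  simp [quad, mul, inner_add_right]

lemma quad_smul (c : ℝ) (M : Matrix (Fin k) (Fin k) ℝ) (v : E k) :
    quad (c • M) v = c * quad M v := by
  simp [quad, mul, inner_smul_right]

lemma quad_transpose_mul_mul (A : Matrix (Fin k) (Fin l) ℝ) (V : Matrix (Fin k) (Fin k) ℝ)
    (v : E l) : quad (Aᵀ * V * A) v = quad V (mul A v) := by
  rw [quad, mul_mul, mul_mul, inner_mul_transpose, quad]

lemma quad_eq_dotProduct (M : Matrix (Fin k) (Fin k) ℝ) (v : E k) :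
    quad M v = v.ofLp ⬝ᵥ M *ᵥ v.ofLp := by
  simp [quad, mul, Matrix.toLpLin_apply, EuclideanSpace.inner_eq_star_dotProduct,
    dotProduct_comm]

lemma quad_pos {M : Matrix (Fin k) (Fin k) ℝ} (hM : M.PosDef) {v : E k} (hv : v ≠ 0) :
    0 < quad M v := by
  have h : v.ofLp ≠ 0 := by simpa using hv
  simpa [quad_eq_dotProduct] using hM.dotProduct_mulVec_pos h

lemma quad_nonneg {M : Matrix (Fin k) (Fin k) ℝ} (hM : M.PosSemidef) (v : E k) :
    0 ≤ quad M v := by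
  simpa [quad_eq_dotProduct] using hM.dotProduct_mulVec_nonneg v.ofLp

lemma quad_smul_vec (M : Matrix (Fin k) (Fin k) ℝ) (a : ℝ) (v : E k) :
    quad M (a • v) = a ^ 2 * quad M v := by
  simp only [quad, mul, map_smul, inner_smul_left, inner_smul_right]
  simp; ring

/-- Compactness of the unit sphere and homogeneity of degree two; the sphere is empty when `k = 0`.
-/
lemma exists_coercive {M : Matrix (Fin k) (Fin k) ℝ} (hM : ∀ v : E k, v ≠ 0 → 0 < quad M v) :
    ∃ c > 0, ∀ v : E k, c * ‖v‖ ^ 2 ≤ quad M v := by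
  have hcont : Continuous (quad M) := by
    unfold quad mul
    exact continuous_id.inner (LinearMap.continuous_of_finiteDimensional _)
  rcases (Metric.sphere (0 : E k) 1).eq_empty_or_nonempty with he | hne
  · refine ⟨1, one_pos, fun v => ?_⟩
    have hv : v = 0 := by
      by_contra hv
      have : ‖v‖⁻¹ • v ∈ Metric.sphere (0 : E k) 1 := by
        simp [norm_smul, norm_ne_zero_iff.mpr hv]
      simp [he] at this
    simp [hv, quad]
  · obtain ⟨w, hw, hmin⟩ := (isCompact_sphere (0 : E k) 1).exists_isMinOn hne hcont.continuousOn
    have hw0 : w ≠ 0 := by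
      rintro rfl
      simp at hw
    refine ⟨quad M w, hM w hw0, fun v => ?_⟩
    rcases eq_or_ne v 0 with rfl | hv
    · simp [quad]
    have hn := norm_pos_iff.mpr hv
    have hmem : ‖v‖⁻¹ • v ∈ Metric.sphere (0 : E k) 1 := by simp [norm_smul, hn.ne']
    have h1 : quad M w ≤ quad M (‖v‖⁻¹ • v) := hmin hmem
    rw [quad_smul_vec, inv_pow, inv_mul_eq_div, le_div_iff₀ (by positivity)] at h1
    exact h1

lemma mul_inv_cancel_vec {H : Matrix (Fin k) (Fin k) ℝ} (hH : H.PosDef) (v : E k) :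
    mul H (mul H⁻¹ v) = v := by
  rw [← mul_mul, Matrix.mul_nonsing_inv _ ((Matrix.isUnit_iff_isUnit_det _).mp hH.isUnit)]
  simp [mul]

/-- With `v = H⁻¹ w`, coercivity and Cauchy–Schwarz give `c ‖v‖² ≤ ⟪v, w⟫ ≤ ‖v‖ ‖w‖`. -/
lemma norm_inv_le {H : Matrix (Fin k) (Fin k) ℝ} (hH : H.PosDef) {c : ℝ} (hc : 0 < c)
    (h : ∀ v : E k, c * ‖v‖ ^ 2 ≤ quad H v) : ‖H⁻¹‖ ≤ c⁻¹ := by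
  refine norm_le_of_forall_norm_mul_le (by positivity) fun w => ?_
  set v := mul H⁻¹ w with hv
  have h1 := h v
  rw [quad, hv, mul_inv_cancel_vec hH, ← hv] at h1
  have h2 := h1.trans (real_inner_le_norm v w)
  rw [inv_mul_eq_div, le_div_iff₀ hc]
  rcases (norm_nonneg v).eq_or_lt with h0 | h0
  · rw [← h0]; simp
  · nlinarith

/-- Test the form on unit eigenvectors. Positivity of `k` matters: for `k = 0` the spectrum is empty
and `sInf` takes its default value `0`. -/
lemma le_lambdaMin (hk : 0 < k) {H : Matrix (Fin k) (Fin k) ℝ} (hH : H.IsHermitian) {c : ℝ}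
    (h : ∀ v : E k, c * ‖v‖ ^ 2 ≤ quad H v) : c ≤ lambdaMin H := by
  have : Nonempty (Fin k) := ⟨⟨0, hk⟩⟩
  rw [lambdaMin, hH.spectrum_real_eq_range_eigenvalues]
  refine le_csInf (range_nonempty _) ?_
  rintro _ ⟨i, rfl⟩
  have h1 := h (hH.eigenvectorBasis i)
  have h2 : mul H (hH.eigenvectorBasis i) = hH.eigenvalues i • hH.eigenvectorBasis i := by
    have := hH.mulVec_eigenvectorBasis i
    rw [mul, Matrix.toLpLin_apply, this]
    rfl
  rw [quad, h2, inner_smul_right] at h1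
  simpa using h1

lemma abs_trace_le (N : Matrix (Fin k) (Fin k) ℝ) : |N.trace| ≤ k * ‖N‖ := by
  have h : ∀ i, |N i i| ≤ ‖N‖ := fun i => by
    have h1 : inner ℝ (EuclideanSpace.single i (1 : ℝ)) (mul N (EuclideanSpace.single i 1)) =
        N i i := by
      simp [mul, EuclideanSpace.inner_single_left]
    rw [← h1]
    refine (abs_real_inner_le_norm _ _).trans ?_
    have := norm_mul_le N (EuclideanSpace.single i (1 : ℝ))
    simpa using this
  calc |N.trace| ≤ ∑ i, |N i i| := Finset.abs_sum_le_sum_abs _ _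
    _ ≤ ∑ _i : Fin k, ‖N‖ := Finset.sum_le_sum fun i _ => h i
    _ = k * ‖N‖ := by simp

/-- For positive definite `V`, `Aᵀ V A` is symmetric with the same kernel as `A`, so its range is
the orthogonal complement of `ker A`. -/
lemma exists_eq_mul_of_orthogonal_ker {A : Matrix (Fin k) (Fin l) ℝ}
    {V : Matrix (Fin k) (Fin k) ℝ} (hV : V.PosDef) {u : E l}
    (hu : ∀ v : E l, mul A v = 0 → inner ℝ v u = 0) : ∃ z : E l, u = mul (Aᵀ * V * A) z := by
  set B := Aᵀ * V * A with hB
  have hsymm : (Matrix.toEuclideanLin B).IsSymmetric := by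
    rw [Matrix.isSymmetric_toEuclideanLin_iff]
    have := Matrix.isHermitian_conjTranspose_mul_mul A hV.isHermitian
    rwa [Matrix.conjTranspose_eq_transpose_of_trivial] at this
  have hmem : u ∈ (Matrix.toEuclideanLin B).range := by
    rw [← Submodule.orthogonal_orthogonal (Matrix.toEuclideanLin B).range,
      hsymm.orthogonal_range, Submodule.mem_orthogonal]
    intro v hv
    apply hu
    by_contra hne
    have h1 := quad_pos hV hne
    rw [← quad_transpose_mul_mul, ← hB, quad] at h1
    rw [LinearMap.mem_ker] at hv
    simp [mul, hv] at h1
  obtain ⟨z, hz⟩ := hmem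
  exact ⟨z, hz.symm⟩

/-- Each column of `Aᵀ` is orthogonal to `ker A`, so it lies in the range of `Aᵀ V A`; the preimages
are the columns of `Z`. -/
lemma exists_transpose_eq_mul (A : Matrix (Fin k) (Fin l) ℝ)
    {V : Matrix (Fin k) (Fin k) ℝ} (hV : V.PosDef) :
    ∃ Z : Matrix (Fin l) (Fin k) ℝ, Aᵀ = Aᵀ * V * A * Z := by
  have h : ∀ i : Fin k, ∃ z : E l,
      mul Aᵀ (EuclideanSpace.single i 1) = mul (Aᵀ * V * A) z := fun i =>
    exists_eq_mul_of_orthogonal_ker hV fun v hv => by rw [inner_mul_transpose, hv, inner_zero_left]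
  choose z hz using h
  refine ⟨Matrix.of fun j i => z i j, ?_⟩
  ext j i
  have := congrArg (fun w : E l => w j) (hz i)
  have h1 : (mul Aᵀ (EuclideanSpace.single i 1)) j = Aᵀ j i := by simp [mul]
  exact h1.symm.trans (this.trans rfl)

/-- Bounds for the inverses of `B + ν Q`, uniform as `ν → 0`, when `B + ν₀ Q` is positive definite
for one value `ν₀`. -/
lemma regularized_bounds {B Q : Matrix (Fin k) (Fin k) ℝ} {ν₀ : ℝ} (hν₀ : 0 < ν₀)
    (hB : ∀ v : E k, 0 ≤ quad B v) (h₀ : (B + ν₀ • Q).PosDef) :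
    ∃ c > 0, ∃ K : ℝ, ∀ ν, 0 < ν → ν ≤ ν₀ / 2 → (B + ν • Q).PosDef →
      (∀ v : E k, c * ν * ‖v‖ ^ 2 ≤ quad (B + ν • Q) v) ∧
      (∀ v : E k, quad B v / 2 ≤ quad (B + ν • Q) v) ∧
      ‖(B + ν • Q)⁻¹ * B‖ ≤ K := by
  obtain ⟨c₀, hc₀, hcoer⟩ := exists_coercive fun v hv => quad_pos h₀ hv
  refine ⟨c₀ / ν₀, by positivity, 2 * (‖(1 : Matrix (Fin k) (Fin k) ℝ)‖ +
    c₀⁻¹ * ‖B + ν₀ • Q‖), fun ν hν hν2 hH => ?_⟩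
  -- `B + ν Q` is the convex combination of `B` and `B + ν₀ Q` with weight `t` on the latter. No
  -- sign of `Q` is needed, and `t ≤ 1/2` keeps at least half of `B`.
  set t := ν / ν₀ with ht
  have ht0 : 0 < t := by positivity
  have ht2 : t ≤ 1 / 2 := by rw [ht, div_le_iff₀ hν₀]; linarith
  have htν : t * ν₀ = ν := by rw [ht]; field_simp
  have hdec : B + ν • Q = (1 - t) • B + t • (B + ν₀ • Q) := by
    rw [smul_add, smul_smul, htν, sub_smul, one_smul]; abel
  have hq : ∀ v, quad (B + ν • Q) v = (1 - t) * quad B v + t * quad (B + ν₀ • Q) v := fun v => by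
    rw [hdec, quad_add, quad_smul, quad_smul]
  have hco : ∀ v : E k, c₀ * t * ‖v‖ ^ 2 ≤ quad (B + ν • Q) v := fun v => by
    rw [hq]
    nlinarith [hB v, hcoer v, mul_le_mul_of_nonneg_left (hcoer v) ht0.le]
  refine ⟨fun v => ?_, fun v => ?_, ?_⟩
  · have := hco v
    rwa [show c₀ / ν₀ * ν = c₀ * t by rw [ht]; ring]
  · have h1 := (mul_nonneg hc₀.le (sq_nonneg ‖v‖)).trans (hcoer v)
    rw [hq]
    nlinarith [hB v, mul_nonneg ht0.le h1]
  · have hinv := norm_inv_le hH (mul_pos hc₀ ht0) hco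
    set H := B + ν • Q with hHdef
    set H₀ := B + ν₀ • Q
    have hmul : H⁻¹ * H = 1 :=
      Matrix.nonsing_inv_mul _ ((Matrix.isUnit_iff_isUnit_det _).mp hH.isUnit)
    -- The factor `t` on the right cancels the blow-up `‖H⁻¹‖ ≤ (c₀ t)⁻¹`, which makes the bound
    -- uniform in `ν`.
    have hid : (1 - t) • (H⁻¹ * B) = 1 - t • (H⁻¹ * H₀) := by
      rw [eq_sub_iff_add_eq, ← Matrix.mul_smul, ← Matrix.mul_smul, ← mul_add, ← hdec, hmul]
    have h1 : (1 - t) * ‖H⁻¹ * B‖ ≤ ‖(1 : Matrix (Fin k) (Fin k) ℝ)‖ + c₀⁻¹ * ‖H₀‖ := by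
      calc (1 - t) * ‖H⁻¹ * B‖ = ‖(1 - t) • (H⁻¹ * B)‖ := by
            rw [norm_smul, Real.norm_of_nonneg (by linarith)]
        _ ≤ ‖(1 : Matrix (Fin k) (Fin k) ℝ)‖ + ‖t • (H⁻¹ * H₀)‖ := by
            rw [hid]; exact norm_sub_le _ _
        _ ≤ _ := by
            gcongr
            rw [norm_smul, Real.norm_of_nonneg ht0.le]
            calc t * ‖H⁻¹ * H₀‖ ≤ t * ((c₀ * t)⁻¹ * ‖H₀‖) := by
                  gcongr
                  exact (Matrix.l2_opNorm_mul _ _).trans (by gcongr)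
              _ = c₀⁻¹ * ‖H₀‖ := by field_simp
    nlinarith [norm_nonneg (H⁻¹ * B)]

end LinearAlgebra

end BayesGLIP

namespace BayesGLIP

/-! ### Ky Fan and Prokhorov distances -/

section KyFan

variable {Ω W : Type*} [MeasurableSpace Ω] {P : Measure Ω} {d : W → W → ℝ} {ξ₁ ξ₂ : Ω → W}

lemma kyFan_nonneg : 0 ≤ kyFan P d ξ₁ ξ₂ := Real.sInf_nonneg fun _ hε => hε.1.le

lemma kyFan_le {ε : ℝ} (hε : 0 < ε) (h : P {ω | ε < d (ξ₁ ω) (ξ₂ ω)} < ENNReal.ofReal ε) :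
    kyFan P d ξ₁ ξ₂ ≤ ε :=
  csInf_le ⟨0, fun _ h => h.1.le⟩ ⟨hε, h⟩

/-- The infimum in the definition of the Ky Fan distance satisfies the non-strict inequality. -/
lemma measure_kyFan_lt_le [IsProbabilityMeasure P] :
    P {ω | kyFan P d ξ₁ ξ₂ < d (ξ₁ ω) (ξ₂ ω)} ≤ ENNReal.ofReal (kyFan P d ξ₁ ξ₂) := by
  set κ := kyFan P d ξ₁ ξ₂ with hκ
  have hne : {ε : ℝ | 0 < ε ∧ P {ω | ε < d (ξ₁ ω) (ξ₂ ω)} < ENNReal.ofReal ε}.Nonempty :=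
    ⟨2, two_pos, prob_le_one.trans_lt (by simp)⟩
  have hlt : ∀ ε > κ, P {ω | ε < d (ξ₁ ω) (ξ₂ ω)} ≤ ENNReal.ofReal ε := fun ε hε => by
    obtain ⟨ε', ⟨_, h'⟩, hlt⟩ := exists_lt_of_csInf_lt hne hε
    exact (measure_mono fun ω (hω : ε < _) => hlt.trans hω).trans
      (h'.le.trans (ENNReal.ofReal_le_ofReal hlt.le))
  -- The infimum need not be attained: approach it from above by `u j`, along which the events
  -- increase to `{κ < d}`, and use continuity from below.
  obtain ⟨u, hanti, hu, hlim⟩ := exists_seq_strictAnti_tendsto κ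
  have hset : {ω | κ < d (ξ₁ ω) (ξ₂ ω)} = ⋃ j, {ω | u j < d (ξ₁ ω) (ξ₂ ω)} := by
    ext ω
    simp only [mem_ofPred_eq, mem_iUnion]
    exact ⟨fun h => (hlim.eventually_lt_const h).exists, fun ⟨j, hj⟩ => (hu j).trans hj⟩
  have hmono : Monotone fun j => {ω | u j < d (ξ₁ ω) (ξ₂ ω)} := fun i j hij ω hω =>
    (hanti.antitone hij).trans_lt hω
  rw [hset]
  exact le_of_tendsto_of_tendsto' (tendsto_measure_iUnion_atTop hmono)
    ((ENNReal.continuous_ofReal.tendsto κ).comp hlim) fun j => hlt _ (hu j)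

end KyFan

/-- A probability measure with little mass outside a small ball is close to the point mass at the
centre. -/
lemma levyProkhorovDist_dirac_le {S : Type*} [PseudoMetricSpace S] [MeasurableSpace S]
    [OpensMeasurableSpace S] {μ : Measure S} [IsProbabilityMeasure μ] {x : S} {r : ℝ}
    (hr : 0 ≤ r) (h : μ (Metric.closedBall x r)ᶜ ≤ ENNReal.ofReal r) :
    levyProkhorovDist μ (Measure.dirac x) ≤ r := by
  refine ENNReal.toReal_le_of_le_ofReal hr (levyProkhorovEDist_le_of_forall _ _ _ ?_)
  intro ε B hε hεtop hB
  have hrε : r < ε.toReal := (ENNReal.ofReal_lt_iff_lt_toReal hr hεtop.ne).mp hε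
  constructor
  -- If `x` is outside the thickening of `B`, then `B` misses the closed ball of radius `r`, so its
  -- mass is at most `r`.
  · by_cases hx : x ∈ Metric.thickening ε.toReal B
    · rw [Measure.dirac_apply' _ Metric.isOpen_thickening.measurableSet, indicator_of_mem hx]
      exact prob_le_one.trans le_self_add
    · refine (measure_mono ?_).trans (h.trans (hε.le.trans le_add_self))
      intro y hy hyx
      exact hx (Metric.mem_thickening_iff.mpr
        ⟨y, hy, by rw [dist_comm]; exact (Metric.mem_closedBall.mp hyx).trans_lt hrε⟩)
  · by_cases hx : x ∈ B
    · have hsub : Metric.closedBall x r ⊆ Metric.thickening ε.toReal B := fun y hy =>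
        Metric.mem_thickening_iff.mpr ⟨x, hx, (Metric.mem_closedBall.mp hy).trans_lt hrε⟩
      have h1 : (1 : ENNReal) ≤ μ (Metric.closedBall x r) + μ (Metric.closedBall x r)ᶜ := by
        rw [measure_add_measure_compl Metric.isClosed_closedBall.measurableSet, measure_univ]
      exact prob_le_one.trans (h1.trans (add_le_add (measure_mono hsub) (h.trans hε.le)))
    · rw [Measure.dirac_apply' _ hB, indicator_of_notMem hx]
      exact zero_le

/-! ### Concentration of the posterior -/

namespace Problem

variable {n p : ℕ} {M : Problem n p}

lemma unnormPosterior_apply {ν τ : ℝ} {y : E n}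
    (hint : IntegrableOn (fun x => Real.exp (-(M.h ν y x) / τ)) M.X) {S : Set (E p)}
    (hS : MeasurableSet S) :
    M.unnormPosterior ν τ y S =
      ENNReal.ofReal (∫ x in M.X ∩ S, Real.exp (-(M.h ν y x) / τ)) := by
  rw [unnormPosterior, withDensity_apply _ hS, Measure.restrict_restrict hS, inter_comm,
    ofReal_integral_eq_lintegral_ofReal]
  · exact hint.mono_set inter_subset_left
  · exact Eventually.of_forall fun x => (Real.exp_pos _).le

lemma integral_exp_sub {ν τ : ℝ} {y : E n} (S : Set (E p)) :
    ∫ x in S, Real.exp (-(M.h ν y x - M.h ν y M.xStar) / τ) =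
      Real.exp (M.h ν y M.xStar / τ) * ∫ x in S, Real.exp (-(M.h ν y x) / τ) := by
  rw [← integral_const_mul]
  congr 1 with x
  rw [← Real.exp_add]
  congr 1
  ring

lemma setIntegral_exp_ball_pos {ν τ δ : ℝ} {y : E n}
    (hint : IntegrableOn (fun x => Real.exp (-(M.h ν y x) / τ)) M.X)
    (hx : M.xStar ∈ interior M.X) (hδ : 0 < δ) :
    0 < ∫ x in M.X ∩ Metric.closedBall M.xStar δ, Real.exp (-(M.h ν y x) / τ) := by
  have hne : volume (M.X ∩ Metric.closedBall M.xStar δ) ≠ 0 := by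
    refine (MeasureTheory.Measure.measure_pos_of_mem_nhds volume (inter_mem (mem_interior_iff_mem_nhds.mp hx)
      (Metric.closedBall_mem_nhds _ hδ))).ne'
  have : NeZero (volume.restrict (M.X ∩ Metric.closedBall M.xStar δ)) :=
    ⟨by rwa [Ne, Measure.restrict_eq_zero]⟩
  exact integral_exp_pos (hint.mono_set inter_subset_left)

/-- The total mass is at least the mass in the ball, so the normalised outer mass is at most the
ratio `Δ₀`. Interiority of `xStar` makes the inner mass positive. -/
lemma posterior_bounds {ν τ δ ε : ℝ} {y : E n}
    (hint : IntegrableOn (fun x => Real.exp (-(M.h ν y x) / τ)) M.X)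
    (hx : M.xStar ∈ interior M.X) (hδ : 0 < δ)
    (htail : M.Δ₀ ν τ δ y ≤ ε) :
    IsProbabilityMeasure (M.posterior ν τ y) ∧
      M.posterior ν τ y (Metric.closedBall M.xStar δ)ᶜ ≤ ENNReal.ofReal ε := by
  have hin := setIntegral_exp_ball_pos hint hx hδ
  set I := ∫ x in M.X ∩ Metric.closedBall M.xStar δ, Real.exp (-(M.h ν y x) / τ)
  have hball := unnormPosterior_apply hint (S := Metric.closedBall M.xStar δ)
    Metric.isClosed_closedBall.measurableSet
  have hout := unnormPosterior_apply hint (S := (Metric.closedBall M.xStar δ)ᶜ)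
    Metric.isClosed_closedBall.measurableSet.compl
  have huniv := unnormPosterior_apply hint MeasurableSet.univ
  have hle : M.unnormPosterior ν τ y (Metric.closedBall M.xStar δ) ≤
      M.unnormPosterior ν τ y univ := measure_mono (subset_univ _)
  have hIpos : 0 < ENNReal.ofReal I := ENNReal.ofReal_pos.mpr hin
  have h0 : M.unnormPosterior ν τ y univ ≠ 0 := (hIpos.trans_le (hball ▸ hle)).ne'
  have htop : M.unnormPosterior ν τ y univ ≠ ⊤ := by rw [huniv]; exact ENNReal.ofReal_ne_top
  rw [Δ₀, integral_exp_sub, integral_exp_sub, mul_div_mul_left _ _ (Real.exp_pos _).ne',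
    div_le_iff₀ hin, sdiff_eq] at htail
  refine ⟨⟨by simp [posterior, ENNReal.inv_mul_cancel h0 htop]⟩, ?_⟩
  have hεnn : 0 ≤ ε := by
    have h1 : 0 ≤ ∫ x in M.X ∩ (Metric.closedBall M.xStar δ)ᶜ, Real.exp (-(M.h ν y x) / τ) :=
      integral_nonneg fun x => (Real.exp_pos _).le
    exact nonneg_of_mul_nonneg_left (h1.trans htail) hin
  rw [posterior, Measure.smul_apply, smul_eq_mul, mul_comm, ← div_eq_mul_inv]
  refine ENNReal.div_le_of_le_mul ?_
  calc M.unnormPosterior ν τ y (Metric.closedBall M.xStar δ)ᶜ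
      ≤ ENNReal.ofReal (ε * I) := by rw [hout]; exact ENNReal.ofReal_le_ofReal htail
    _ = ENNReal.ofReal ε * ENNReal.ofReal I := ENNReal.ofReal_mul hεnn
    _ ≤ _ := by
      gcongr
      exact hball ▸ hle

/-- The likelihood does not charge the complement of `Yset`, so up to a null set leaving `Yloc`
means being farther than the Ky Fan distance from the exact data. -/
lemma measure_notMem_Yloc_le {Ω : Type*} [MeasurableSpace Ω] {P : ℝ → Measure Ω}
    [∀ τ, IsProbabilityMeasure (P τ)] {Y : ℝ → Ω → E n} (hmodel : M.IsModel)
    (hdata : M.IsData P Y) {τ : ℝ} (hτ : 0 < τ) :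
    P τ {ω | Y τ ω ∉ M.Yloc (kyFan (P τ) dist (Y τ) fun _ => M.yExact)} ≤
      ENNReal.ofReal (kyFan (P τ) dist (Y τ) fun _ => M.yExact) := by
  have h0 : P τ (Y τ ⁻¹' M.Ysetᶜ) = 0 := by
    rw [← Measure.map_apply (hdata.measurable τ hτ) hmodel.measurableSet_Yset.compl,
      hdata.law τ hτ, likelihood]
    refine withDensity_absolutelyContinuous _ _ ?_
    rw [Measure.restrict_apply hmodel.measurableSet_Yset.compl]
    simp
  set κ := kyFan (P τ) dist (Y τ) fun _ => M.yExact
  have hsub : {ω | Y τ ω ∉ M.Yloc κ} ⊆ Y τ ⁻¹' M.Ysetᶜ ∪ {ω | κ < dist (Y τ ω) M.yExact} := by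
    intro ω hω
    by_contra hcon
    rw [mem_union, not_or] at hcon
    exact hω ⟨not_not.mp hcon.1, not_lt.mp hcon.2⟩
  calc P τ {ω | Y τ ω ∉ M.Yloc κ}
      ≤ P τ (Y τ ⁻¹' M.Ysetᶜ) + P τ {ω | κ < dist (Y τ ω) M.yExact} :=
        (measure_mono hsub).trans (measure_union_le _ _)
    _ ≤ ENNReal.ofReal κ := by
        rw [h0, zero_add]
        exact measure_kyFan_lt_le

lemma tendsto_kyFan_data {Ω : Type*} [MeasurableSpace Ω] {P : ℝ → Measure Ω}
    {Y : ℝ → Ω → E n} (hdata : M.IsData P Y) :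
    Tendsto (fun τ => kyFan (P τ) dist (Y τ) fun _ => M.yExact) (𝓝[>] 0) (𝓝 0) := by
  refine tendsto_order.mpr ⟨fun a ha => Eventually.of_forall fun τ => ha.trans_le kyFan_nonneg,
    fun a ha => ?_⟩
  have h2 : (0 : ℝ) < a / 2 := by positivity
  filter_upwards [(hdata.tendsto _ h2).eventually_lt_const (ENNReal.ofReal_pos.mpr h2)] with τ hτ
  refine (kyFan_le h2 ((measure_mono ?_).trans_lt hτ)).trans_lt (by linarith)
  exact fun ω (hω : a / 2 < dist (Y τ ω) M.yExact) => show a / 2 ≤ dist (Y τ ω) M.yExact from hω.le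

lemma tendsto_kyFan_posterior {Ω : Type*} [MeasurableSpace Ω] {P : ℝ → Measure Ω}
    [∀ τ, IsProbabilityMeasure (P τ)] {Y : ℝ → Ω → E n} {ν δ : ℝ → ℝ} (hmodel : M.IsModel)
    (hdata : M.IsData P Y) (hprior : M.PriorAssumptions ν)
    (hδ : M.DeltaAssumptions (fun τ => kyFan (P τ) dist (Y τ) fun _ => M.yExact) ν δ)
    (hint : M.xStar ∈ interior M.X) :
    Tendsto (fun τ => kyFan (P τ) levyProkhorovDist
        (fun ω => M.posterior (ν τ) τ (Y τ ω)) (fun _ => Measure.dirac M.xStar))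
      (𝓝[>] 0) (𝓝 0) := by
  refine tendsto_order.mpr ⟨fun a ha => Eventually.of_forall fun τ => ha.trans_le kyFan_nonneg,
    fun a ha => ?_⟩
  -- The level `a / 2` serves as bound for `ρ`, for `δ` and for the tail ratio, and leaves room for
  -- the strict inequality.
  have h2 : (0 : ℝ) < a / 2 := by positivity
  obtain ⟨τ₀, hτ₀, hproper⟩ := hprior.proper
  filter_upwards [(tendsto_kyFan_data hdata).eventually_lt_const h2,
    hδ.tendsto_zero.eventually_lt_const h2, hδ.tail _ h2, Ioc_mem_nhdsGT hτ₀]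
    with τ hρ hδτ htail hτ
  refine (kyFan_le h2 (lt_of_le_of_lt ?_ ((ENNReal.ofReal_lt_ofReal_iff h2).mpr hρ))).trans_lt
    (by linarith)
  refine (measure_mono ?_).trans (measure_notMem_Yloc_le hmodel hdata hτ.1)
  intro ω (hω : a / 2 < levyProkhorovDist (M.posterior (ν τ) τ (Y τ ω)) (Measure.dirac M.xStar)) hY
  obtain ⟨hprob, hmass⟩ := posterior_bounds (hproper τ hτ _ hY.1) hint (hδ.pos τ hτ.1)
    (htail _ hY)
  refine hω.not_ge (levyProkhorovDist_dirac_le h2.le ((measure_mono ?_).trans hmass))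
  exact compl_subset_compl.mpr (Metric.closedBall_subset_closedBall hδτ.le)

end Problem

end BayesGLIP

namespace BayesGLIP

open scoped Matrix Matrix.Norms.L2Operator MatrixOrder Gradient

/-! ### Bounds for `H_ν⁻¹` uniform in `ν` -/

namespace Problem

variable {n p : ℕ} {M : Problem n p}

/-- First-order optimality: near `xStar` the line in direction `v ∈ ker A` stays in `X` and in the
solution set, so `g` has a local minimum along it. Without differentiability the gradient is `0` by
convention. -/
lemma inner_gradient_xStar_eq_zero {ν : ℝ → ℝ} (hprior : M.PriorAssumptions ν)
    (hint : M.xStar ∈ interior M.X) {v : E p} (hv : mul M.A v = 0) :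
    inner ℝ v (∇ M.g M.xStar) = 0 := by
  by_cases hd : DifferentiableAt ℝ M.g M.xStar
  swap
  · rw [gradient_eq_zero_of_not_differentiableAt hd, inner_zero_right]
  have hline : HasDerivAt (fun t : ℝ => M.xStar + t • v) v 0 := by
    simpa using ((hasDerivAt_id (0 : ℝ)).smul_const v).const_add M.xStar
  have hg : HasFDerivAt M.g (fderiv ℝ M.g M.xStar) (M.xStar + (0 : ℝ) • v) := by
    simpa using hd.hasFDerivAt
  have hcomp := hg.comp_hasDerivAt (0 : ℝ) hline
  have hmin : IsLocalMin (M.g ∘ fun t : ℝ => M.xStar + t • v) 0 := by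
    have hX : M.X ∈ 𝓝 (M.xStar + (0 : ℝ) • v) := by
      simpa using mem_interior_iff_mem_nhds.mp hint
    filter_upwards [hline.continuousAt.preimage_mem_nhds hX] with t ht
    simp only [Function.comp_apply, zero_smul, add_zero]
    by_cases heq : M.xStar + t • v = M.xStar
    · rw [heq]
    · refine (hprior.xStar_unique _ ht ?_ heq).le
      rw [← hprior.xStar_solution]
      simp only [mul] at hv ⊢
      rw [map_add, map_smul, hv, smul_zero, add_zero]
  have h0 := hmin.hasDerivAt_eq_zero hcomp
  rw [real_inner_comm, inner_gradient_left]
  exact h0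

/-- The regularisation of the normal equations at `xStar`, uniformly as `ν → 0`. -/
lemma exists_uniform_bounds {ν : ℝ → ℝ} (hν : ∀ τ > 0, 0 < ν τ)
    (hprior : M.PriorAssumptions ν) (hint : M.xStar ∈ interior M.X)
    (hV : (M.V M.yExact M.xStar).PosDef)
    (hH : ∀ᶠ τ in 𝓝[>] (0 : ℝ), (M.H (ν τ)).PosDef)
    (hν0 : Tendsto ν (𝓝[>] 0) (𝓝 0)) :
    ∃ c > 0, ∃ K > 0, ∀ᶠ τ in 𝓝[>] (0 : ℝ),
      (∀ v : E p, c * ν τ * ‖v‖ ^ 2 ≤ quad (M.H (ν τ)) v) ∧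
      ((M.Aᵀ * M.A).rank = p → ∀ v : E p, c * ‖v‖ ^ 2 ≤ quad (M.H (ν τ)) v) ∧
      ‖(M.H (ν τ))⁻¹ * M.Aᵀ‖ ≤ K ∧ M.c₂ (ν τ) ≤ K := by
  set B := M.Aᵀ * M.V M.yExact M.xStar * M.A with hBdef
  have hHdef : ∀ s, M.H s = B + s • hess M.g M.xStar := fun s => rfl
  have hB : ∀ v : E p, 0 ≤ quad B v := fun v => by
    rw [hBdef, quad_transpose_mul_mul]
    exact quad_nonneg hV.posSemidef _
  -- One fixed noise level with `H` positive definite supplies the reference value `ν₀ = ν τ₁`;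
  -- smaller `ν` are compared with it.
  obtain ⟨τ₁, h₁, hτ₁⟩ := (hH.and self_mem_nhdsWithin).exists
  have hν₁ := hν τ₁ hτ₁
  obtain ⟨c, hc, K, hbd⟩ := regularized_bounds hν₁ hB h₁
  obtain ⟨Z, hZ⟩ := exists_transpose_eq_mul M.A hV
  obtain ⟨z, hz⟩ := exists_eq_mul_of_orthogonal_ker hV
    (fun v hv => inner_gradient_xStar_eq_zero hprior hint hv)
  -- With full rank `A` is injective, so `B` itself is coercive and `H_ν ≥ B / 2` has a bound free
  -- of `ν`; otherwise the constant is a dummy.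
  have hfull : ∃ c' > 0, (M.Aᵀ * M.A).rank = p → ∀ v : E p, c' * ‖v‖ ^ 2 ≤ quad B v := by
    by_cases hr : (M.Aᵀ * M.A).rank = p
    · obtain ⟨c', hc', h⟩ := exists_coercive (M := B) fun v hv => by
        rw [hBdef, quad_transpose_mul_mul]
        refine quad_pos hV fun h0 => hv ?_
        have hu : IsUnit (M.Aᵀ * M.A) := by
          rw [← Matrix.mulVec_surjective_iff_isUnit, ← Matrix.coe_mulVecLin,
            ← LinearMap.range_eq_top]
          refine Submodule.eq_top_of_finrank_eq ?_
          rw [Module.finrank_fin_fun]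
          exact hr
        have h1 : (M.Aᵀ * M.A) *ᵥ v.ofLp = (M.Aᵀ * M.A) *ᵥ 0 := by
          have h2 := congrArg WithLp.ofLp h0
          rw [mul, Matrix.ofLp_toLpLin, Matrix.toLin'_apply] at h2
          rw [← Matrix.mulVec_mulVec, h2]
          simp
        have h3 := Matrix.mulVec_injective_of_isUnit hu h1
        ext i
        simp [h3]
      exact ⟨c', hc', fun _ => h⟩
    · exact ⟨1, one_pos, fun h => absurd h hr⟩
  obtain ⟨c', hc', hfull⟩ := hfull
  refine ⟨min c (c' / 2), by positivity, max 1 (max (K * ‖Z‖) (K * ‖z‖)), by positivity, ?_⟩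
  filter_upwards [hH, self_mem_nhdsWithin, hν0.eventually_le_const (half_pos hν₁)]
    with τ hHτ hτ hντ
  obtain ⟨b1, b2, b3⟩ := hbd (ν τ) (hν τ hτ) hντ hHτ
  rw [← hHdef] at b1 b2 b3
  refine ⟨fun v => le_trans ?_ (b1 v), fun hr v => le_trans ?_ (b2 v), ?_, ?_⟩
  · have := hν τ hτ
    gcongr
    exact min_le_left _ _
  · have h1 := hfull hr v
    have h2 : min c (c' / 2) * ‖v‖ ^ 2 ≤ c' / 2 * ‖v‖ ^ 2 := by
      gcongr
      exact min_le_right _ _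
    linarith
  · refine le_trans ?_ ((le_max_left _ _).trans (le_max_right _ _))
    conv_lhs => rw [hZ]
    rw [← hBdef, ← Matrix.mul_assoc]
    exact (Matrix.l2_opNorm_mul _ _).trans (by gcongr)
  · refine le_trans ?_ ((le_max_right _ _).trans (le_max_right _ _))
    rw [c₂, hz, ← mul_mul]
    exact (norm_mul_le _ _).trans (by gcongr)

end Problem

end BayesGLIP

namespace BayesGLIP

open scoped Matrix Matrix.Norms.L2Operator MatrixOrder Gradient

/-! ### Rates in `τ` -/

namespace Problem

variable {n p : ℕ} {M : Problem n p}

lemma c₁_le {K ν : ℝ} (hK : ‖(M.H ν)⁻¹ * M.Aᵀ‖ ≤ K) (Mf1 : Matrix (Fin n) (Fin n) ℝ) :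
    M.c₁ ν Mf1 ≤ K * ‖Mf1‖ :=
  (Matrix.l2_opNorm_mul _ _).trans (by gcongr)

/-- In `D` the first term carries an `Aᵀ` on the left and the second a factor `ν`; these are what
`H_ν⁻¹ Aᵀ` and `ν H_ν⁻¹` need to stay bounded. -/
lemma lambdaTilde_le {ν δ ρ K K₀ L : ℝ} (hν : 0 ≤ ν) (hδ : 0 ≤ δ) (hρ : 0 ≤ ρ)
    {Cf : Matrix (Fin n) (Fin n) ℝ} {Cg : Matrix (Fin p) (Fin p) ℝ}
    (hK : ‖(M.H ν)⁻¹ * M.Aᵀ‖ ≤ K) (hK₀ : ν * ‖(M.H ν)⁻¹‖ ≤ K₀)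
    (hCf : ‖Cf‖ ≤ L) (hCg : ‖Cg‖ ≤ L) (Mf2 : Matrix (Fin n) (Fin n) ℝ) :
    M.lambdaTilde ν δ ρ Cf Mf2 Cg ≤
      δ * (‖M.A‖ * (K * L * ‖M.A‖) + K₀ * L) + ρ * (K * ‖Mf2‖ * ‖M.A‖) := by
  have hK0 : 0 ≤ K := (norm_nonneg _).trans hK
  have hK₀0 : 0 ≤ K₀ := (by positivity : 0 ≤ ν * ‖(M.H ν)⁻¹‖).trans hK₀
  have hassoc : ∀ N : Matrix (Fin n) (Fin n) ℝ,
      ‖(M.H ν)⁻¹ * M.Aᵀ * N * M.A‖ ≤ K * ‖N‖ * ‖M.A‖ := fun N =>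
    (Matrix.l2_opNorm_mul _ _).trans (by
      gcongr
      exact (Matrix.l2_opNorm_mul _ _).trans (by gcongr))
  have h1 : (M.H ν)⁻¹ * M.D ν Cf Cg =
      ‖M.A‖ • ((M.H ν)⁻¹ * M.Aᵀ * Cf * M.A) + ν • ((M.H ν)⁻¹ * Cg) := by
    rw [D, mul_add, Matrix.mul_smul, Matrix.mul_smul]
    simp only [Matrix.mul_assoc]
  have h2 : ‖ν • ((M.H ν)⁻¹ * Cg)‖ ≤ K₀ * L := by
    rw [norm_smul, Real.norm_of_nonneg hν]
    calc ν * ‖(M.H ν)⁻¹ * Cg‖ ≤ ν * (‖(M.H ν)⁻¹‖ * ‖Cg‖) := by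
          gcongr
          exact Matrix.l2_opNorm_mul _ _
      _ = ν * ‖(M.H ν)⁻¹‖ * ‖Cg‖ := by ring
      _ ≤ K₀ * L := by gcongr
  have h3 : ‖‖M.A‖ • ((M.H ν)⁻¹ * M.Aᵀ * Cf * M.A)‖ ≤ ‖M.A‖ * (K * L * ‖M.A‖) := by
    rw [norm_smul, norm_norm]
    gcongr
    exact (hassoc Cf).trans (by gcongr)
  unfold lambdaTilde
  gcongr
  · rw [h1]
    exact (norm_add_le _ _).trans (add_le_add h3 h2)
  · exact hassoc Mf2

/-- With full rank `m` is a constant and the rate is `c (δ/√τ)²`; otherwise `m = c ν` and, since `γ²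
= τ/ν`, it is `c (δ/γ)²`. -/
lemma exists_coercivity_rate {ρ ν δ : ℝ → ℝ} {c : ℝ} (hc : 0 < c) (hν : ∀ τ > 0, 0 < ν τ)
    (hδ : M.DeltaAssumptions ρ ν δ)
    (h₁ : ∀ᶠ τ in 𝓝[>] (0 : ℝ), ∀ v : E p, c * ν τ * ‖v‖ ^ 2 ≤ quad (M.H (ν τ)) v)
    (h₂ : (M.Aᵀ * M.A).rank = p →
      ∀ᶠ τ in 𝓝[>] (0 : ℝ), ∀ v : E p, c * ‖v‖ ^ 2 ≤ quad (M.H (ν τ)) v) :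
    ∃ m : ℝ → ℝ, (∀ τ > 0, 0 < m τ) ∧
      (∀ᶠ τ in 𝓝[>] (0 : ℝ), ∀ v : E p, m τ * ‖v‖ ^ 2 ≤ quad (M.H (ν τ)) v) ∧
      Tendsto (fun τ => m τ * δ τ ^ 2 / τ) (𝓝[>] 0) atTop := by
  by_cases hr : (M.Aᵀ * M.A).rank = p
  · refine ⟨fun _ => c, fun _ _ => hc, h₂ hr, ?_⟩
    refine (((tendsto_pow_atTop two_ne_zero).comp hδ.div_sqrt).const_mul_atTop hc).congr' ?_
    filter_upwards [self_mem_nhdsWithin] with τ (hτ : 0 < τ)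
    simp only [Function.comp_apply]
    rw [div_pow, Real.sq_sqrt hτ.le, mul_div_assoc]
  · refine ⟨fun τ => c * ν τ, fun τ hτ => mul_pos hc (hν τ hτ), h₁, ?_⟩
    refine (((tendsto_pow_atTop two_ne_zero).comp (hδ.div_gamma hr)).const_mul_atTop hc).congr' ?_
    filter_upwards [self_mem_nhdsWithin] with τ (hτ : 0 < τ)
    have := hν τ hτ
    simp only [Function.comp_apply]
    rw [div_pow, Real.sq_sqrt (by positivity)]
    field_simp

lemma DeltaAssumptions.eventually_mul_add_lt {ρ ν δ : ℝ → ℝ} (hδ : M.DeltaAssumptions ρ ν δ)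
    (L : ℝ) (hL : 0 < L) : ∀ᶠ τ in 𝓝[>] (0 : ℝ), L * (ρ τ + ν τ) < δ τ := by
  filter_upwards [hδ.dominates.eventually_lt_const (inv_pos.mpr hL), self_mem_nhdsWithin]
    with τ h (hτ : 0 < τ)
  rwa [div_lt_iff₀ (hδ.pos τ hτ), inv_mul_eq_div, lt_div_iff₀' hL] at h

lemma eventually_lambdaTilde_lt_one {ρ ν δ : ℝ → ℝ} {Cf : ℝ → Matrix (Fin n) (Fin n) ℝ}
    {Cg : ℝ → Matrix (Fin p) (Fin p) ℝ} {c K : ℝ} (hc : 0 < c) (hK : 0 < K)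
    (Mf1 Mf2 : Matrix (Fin n) (Fin n) ℝ) (hρnn : ∀ τ, 0 ≤ ρ τ)
    (hρ0 : Tendsto ρ (𝓝[>] 0) (𝓝 0)) (hν : ∀ τ > 0, 0 < ν τ)
    (hx : M.SmoothX ρ δ Cf Cg) (hδ : M.DeltaAssumptions ρ ν δ)
    (hH : ∀ᶠ τ in 𝓝[>] (0 : ℝ), (M.H (ν τ)).PosDef)
    (hbd : ∀ᶠ τ in 𝓝[>] (0 : ℝ), (∀ v : E p, c * ν τ * ‖v‖ ^ 2 ≤ quad (M.H (ν τ)) v) ∧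
      ‖(M.H (ν τ))⁻¹ * M.Aᵀ‖ ≤ K ∧ M.c₂ (ν τ) ≤ K) :
    ∀ᶠ τ in 𝓝[>] (0 : ℝ),
      M.lambdaTilde (ν τ) (δ τ) (ρ τ) (Cf τ) Mf2 (Cg τ) < 1 ∧
      (M.c₁ (ν τ) Mf1 / (1 - M.lambdaTilde (ν τ) (δ τ) (ρ τ) (Cf τ) Mf2 (Cg τ)) * ρ τ +
        M.c₂ (ν τ) / (1 - M.lambdaTilde (ν τ) (δ τ) (ρ τ) (Cf τ) Mf2 (Cg τ)) * ν τ) / 2 < δ τ := by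
  obtain ⟨L, hL⟩ := hx.bounded
  have hlim : Tendsto (fun τ => δ τ * (‖M.A‖ * (K * L * ‖M.A‖) + c⁻¹ * L) +
      ρ τ * (K * ‖Mf2‖ * ‖M.A‖)) (𝓝[>] 0) (𝓝 0) := by
    simpa using (hδ.tendsto_zero.mul_const _).add (hρ0.mul_const _)
  filter_upwards [hlim.eventually_le_const (half_pos one_pos), hbd, hL, hH,
    hδ.eventually_mul_add_lt (K * ‖Mf1‖ + K) (by positivity), self_mem_nhdsWithin]
    with τ hlam ⟨h₁, h₃, h₄⟩ ⟨hCf, hCg⟩ hHτ hs (hτ : 0 < τ)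
  have hντ := hν τ hτ
  have hinv : ν τ * ‖(M.H (ν τ))⁻¹‖ ≤ c⁻¹ := by
    calc ν τ * ‖(M.H (ν τ))⁻¹‖ ≤ ν τ * (c * ν τ)⁻¹ := by
          gcongr
          exact norm_inv_le hHτ (by positivity) h₁
      _ = c⁻¹ := by field_simp
  have hle := (lambdaTilde_le hντ.le (hδ.pos τ hτ).le (hρnn τ) h₃ hinv hCf hCg
    Mf2).trans hlam
  set lam := M.lambdaTilde (ν τ) (δ τ) (ρ τ) (Cf τ) Mf2 (Cg τ)
  refine ⟨by linarith, lt_of_le_of_lt ?_ hs⟩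
  -- As `λ̃ ≤ 1/2`, dividing by `1 - λ̃` costs a factor of at most `2`, which the half in the
  -- condition on `δ` absorbs.
  have hdiv : ∀ a b : ℝ, a ≤ b → 0 ≤ b → a / (1 - lam) ≤ 2 * b := fun a b hab hb => by
    rw [div_le_iff₀ (by linarith)]
    nlinarith
  have e₁ := mul_le_mul_of_nonneg_right
    (hdiv _ _ (c₁_le h₃ Mf1) (by positivity)) (hρnn τ)
  have e₂ := mul_le_mul_of_nonneg_right (hdiv _ _ h₄ hK.le) hντ.le
  have e₃ : 0 ≤ K * ‖Mf1‖ * ν τ := by positivity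
  have e₄ : 0 ≤ K * ρ τ := mul_nonneg hK.le (hρnn τ)
  linarith

end Problem

end BayesGLIP


theorem mainTheorem12 {n p : ℕ} (hp : 0 < p) (M : BayesGLIP.Problem n p)
    {Ω : Type*} [MeasurableSpace Ω] (P : ℝ → Measure Ω) [∀ τ, IsProbabilityMeasure (P τ)]
    (Y : ℝ → Ω → BayesGLIP.E n) (ρ ν δ : ℝ → ℝ)
    (Cf : ℝ → Matrix (Fin n) (Fin n) ℝ) (Cg : ℝ → Matrix (Fin p) (Fin p) ℝ)
    (Mf1 Mf2 : Matrix (Fin n) (Fin n) ℝ)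
    -- `ρ τ` is the Ky Fan distance between the data and the exact data
    (hρ : ∀ τ, ρ τ = BayesGLIP.kyFan (P τ) dist (Y τ) (fun _ => M.yExact))
    (hν : ∀ τ > 0, 0 < ν τ)
    (hmodel : M.IsModel) (hdata : M.IsData P Y) (hprior : M.PriorAssumptions ν)
    (hx : M.SmoothX ρ δ Cf Cg) (hy : M.ConvergenceY ρ Mf1 Mf2)
    (hδ : M.DeltaAssumptions ρ ν δ)
    (hint : M.xStar ∈ interior M.X)
    (hV : (M.V M.yExact M.xStar).PosDef)
    (hH : ∀ᶠ τ in 𝓝[>] (0 : ℝ), (M.H (ν τ)).PosDef) :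
    -- the posterior converges to the point mass at `xStar`
    Tendsto (fun τ => BayesGLIP.kyFan (P τ) levyProkhorovDist
        (fun ω => M.posterior (ν τ) τ (Y τ ω)) (fun _ => Measure.dirac M.xStar))
      (𝓝[>] 0) (𝓝 0) ∧
    -- and the conditions listed as necessary for this convergence hold
    Tendsto ρ (𝓝[>] 0) (𝓝 0) ∧
    Tendsto ν (𝓝[>] 0) (𝓝 0) ∧
    Tendsto (fun τ => τ * (M.H (ν τ))⁻¹.trace) (𝓝[>] 0) (𝓝 0) ∧
    Tendsto δ (𝓝[>] 0) (𝓝 0) ∧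
    Tendsto (fun τ => BayesGLIP.lambdaMin (M.H (ν τ)) * δ τ ^ 2 / τ) (𝓝[>] 0) atTop ∧
    (∀ᶠ τ in 𝓝[>] (0 : ℝ),
      M.lambdaTilde (ν τ) (δ τ) (ρ τ) (Cf τ) Mf2 (Cg τ) < 1 ∧
      (M.c₁ (ν τ) Mf1 / (1 - M.lambdaTilde (ν τ) (δ τ) (ρ τ) (Cf τ) Mf2 (Cg τ)) * ρ τ +
        M.c₂ (ν τ) / (1 - M.lambdaTilde (ν τ) (δ τ) (ρ τ) (Cf τ) Mf2 (Cg τ)) * ν τ) / 2 < δ τ) ∧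
    Tendsto (fun τ => δ τ * ρ τ / √τ) (𝓝[>] 0) (𝓝 0) := by

  have hρ' : ρ = fun τ => BayesGLIP.kyFan (P τ) dist (Y τ) fun _ => M.yExact := funext hρ
  have hρnn : ∀ τ, 0 ≤ ρ τ := fun τ => by rw [hρ]; exact BayesGLIP.kyFan_nonneg
  have hρ0 : Tendsto ρ (𝓝[>] 0) (𝓝 0) := by
    rw [hρ']; exact BayesGLIP.Problem.tendsto_kyFan_data hdata
  have hν0 : Tendsto ν (𝓝[>] 0) (𝓝 0) := by
    refine tendsto_of_tendsto_of_tendsto_of_le_of_le' tendsto_const_nhds hδ.tendsto_zero ?_ ?_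
    · filter_upwards [self_mem_nhdsWithin] with τ hτ using (hν τ hτ).le
    · filter_upwards [hδ.eventually_mul_add_lt 1 one_pos] with τ h
      linarith [hρnn τ]
  obtain ⟨c, hc, K, hK, hbd⟩ :=
    BayesGLIP.Problem.exists_uniform_bounds hν hprior hint hV hH hν0
  obtain ⟨m, hm, hcoer, hrate⟩ := BayesGLIP.Problem.exists_coercivity_rate hc hν hδ
    (hbd.mono fun τ h => h.1) fun hr => hbd.mono fun τ h => h.2.1 hr
  refine ⟨?_, hρ0, hν0, ?_, hδ.tendsto_zero, ?_, ?_, ?_⟩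
  · exact BayesGLIP.Problem.tendsto_kyFan_posterior hmodel hdata hprior (hρ' ▸ hδ) hint
  -- The trace is at most `p / m`, and `τ / m = δ² (m δ² / τ)⁻¹` is a product of two null
  -- quantities.
  · have hlim : Tendsto (fun τ => p * (δ τ ^ 2 * (m τ * δ τ ^ 2 / τ)⁻¹)) (𝓝[>] 0) (𝓝 0) := by
      simpa using ((hδ.tendsto_zero.pow 2).mul hrate.inv_tendsto_atTop).const_mul (p : ℝ)
    refine squeeze_zero_norm' ?_ hlim
    filter_upwards [hH, hcoer, self_mem_nhdsWithin] with τ hHτ hco (hτ : 0 < τ)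
    have hmτ := hm τ hτ
    have hδτ := hδ.pos τ hτ
    rw [norm_mul, Real.norm_of_nonneg hτ.le, Real.norm_eq_abs]
    calc τ * |(M.H (ν τ))⁻¹.trace| ≤ τ * (p * (m τ)⁻¹) := by
          gcongr
          refine (BayesGLIP.abs_trace_le _).trans ?_
          gcongr
          exact BayesGLIP.norm_inv_le hHτ hmτ hco
      _ = p * (δ τ ^ 2 * (m τ * δ τ ^ 2 / τ)⁻¹) := by field_simp
  · refine tendsto_atTop_mono' _ ?_ hrate
    filter_upwards [hH, hcoer, self_mem_nhdsWithin] with τ hHτ hco (hτ : 0 < τ)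
    have := BayesGLIP.le_lambdaMin hp hHτ.isHermitian hco
    gcongr
  · exact BayesGLIP.Problem.eventually_lambdaTilde_lt_one hc hK Mf1 Mf2 hρnn hρ0 hν hx hδ hH
      (hbd.mono fun τ h => ⟨h.1, h.2.2⟩)
  -- Squaring gives `δ² ρ² / τ ≤ δ · (δ (ρ + ν)² / τ)`, where both factors tend to `0`.
  · have hlim : Tendsto (fun τ => √(δ τ * (δ τ * (ρ τ + ν τ) ^ 2 / τ))) (𝓝[>] 0) (𝓝 0) := by
      simpa using (hδ.tendsto_zero.mul hδ.mul_sq).sqrt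
    refine tendsto_of_tendsto_of_tendsto_of_le_of_le' tendsto_const_nhds hlim ?_ ?_
    · filter_upwards [self_mem_nhdsWithin] with τ hτ
      exact div_nonneg (mul_nonneg (hδ.pos τ hτ).le (hρnn τ)) (Real.sqrt_nonneg τ)
    · filter_upwards [self_mem_nhdsWithin] with τ (hτ : 0 < τ)
      refine Real.le_sqrt_of_sq_le ?_
      have hδτ := hδ.pos τ hτ
      have h1 := hν τ hτ
      have h2 := hρnn τ
      calc (δ τ * ρ τ / √τ) ^ 2 = δ τ * (δ τ * ρ τ ^ 2 / τ) := by
            rw [div_pow, Real.sq_sqrt hτ.le]; ring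
        _ ≤ _ := by
            gcongr
            linarith
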